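/- Let $d\ge 3$ be odd, $X=\{1,\dots,d\}$, and let $T$ be the $d$-regular rooted tree with vertex set $X^*$ (the words over $X$), where the children of $u$ are the words $ux$, $x\in X$. Let $\mathrm{Aut}(T)$ be the group of graph automorphisms of $T$ that fix the root; products are written so that the left factor acts first, $gh(u)=h(g(u))$. For $g\in\mathrm{Aut}(T)$ and $u\in X^*$, the section $g|_u\in\mathrm{Aut}(T)$ is defined by $g(uv)=g(u)\,g|_u(v)$ for all $v \in X^*$. Let $G_d\le\mathrm{Aut}(T)$ be the group generated by $A=\{a_1,\dots,a_d\}$, where, with indices modulo $d$, $a_i$ swaps the letters $i$ and $i+1$ on the first level and fixes the other letters, $a_i|_i=a_i$, $a_i|_{i+1}=a_{i+1}$, and $a_i|_x=e$ for all other $x\in X$. The group $G_d$ is self-similar: $g|_u\in G_d$ for all $g\in G_d$ and $u\in X^*$. For a word $w$ over $a_1^{\pm1},\dots,a_d^{\pm1}$, let $|w|_A\in\mathbb Z$ be the sum over all $i$ of the exponent sums of $a_i$ in $w$. Then $|w|_A$ depends only on the element $g\in G_d$ that $w$ represents, so that $|g|_A:=|w|_A$ is well defined. For $k\ge 1$,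 let $\mathrm{St}(k)\le G_d$ be the subgroup of the elements that fix every vertex of $X^k$, and let $\psi_k:\mathrm{St}(k)\to G_d^{\,d^k}$, $g\mapsto (g|_{u_1},\dots,g|_{u_{d^k}})$, where $u_1,\dots,u_{d^k}$ are the words of $X^k$ in lexicographic order. Then, for every $k\ge1$ and all $h_1,\dots,h_{d^k}\in G_d$, the tuple $(h_1,\dots,h_{d^k})$ lies in $\psi_k(\mathrm{St}(k))$ if and only if $$\sum_{i=1}^{d^r}|h_{d^rt+i}|_A\equiv 0 \pmod{2^{r+1}}\qquad\text{for all } 1\le r\le k \text{ and } 0\le t<d^{k-r}.$$ -/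

import Mathlib

namespace TreeGroup

/-- The `d`-regular rooted tree: the vertices are the words over the alphabet `Fin d`, and the
children of a word `u` are the words `u ++ [x]`. The root is the empty word. -/
def tree (d : ℕ) : SimpleGraph (List (Fin d)) where
  Adj u v := (∃ x, v = u ++ [x]) ∨ (∃ x, u = v ++ [x])
  symm := ⟨fun _ _ h => h.symm⟩
  loopless := ⟨fun u h => by
    rcases h with ⟨x, h⟩ | ⟨x, h⟩ <;> simpa using congrArg List.length h⟩

/-- `Aut(T)`: the graph automorphisms of the tree that fix the root, under composition. The
product is `(g * h) u = g (h u)`. -/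
def autTree (d : ℕ) : Subgroup (tree d ≃g tree d) where
  carrier := {g | g [] = []}
  one_mem' := rfl
  mul_mem' {g h} hg hh := by
    change g (h []) = []
    rw [show h [] = [] from hh]; exact hg
  inv_mem' {g} hg := by
    change g.symm [] = []
    rw [RelIso.symm_apply_eq]; exact (show g [] = [] from hg).symm

/-- Automorphisms map children to children. -/
theorem child_of_child {d : ℕ} (g : autTree d) (u : List (Fin d)) (x : Fin d) :
    ∃ y, g.1 (u ++ [x]) = g.1 u ++ [y] := by
  have hroot : g.1 [] = [] := g.2
  induction u using List.reverseRecOn generalizing x with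
  | nil =>
    have h : (tree d).Adj (g.1 []) (g.1 ([] ++ [x])) := g.1.map_rel_iff.2 (Or.inl ⟨x, rfl⟩)
    rcases h with h | ⟨y, h⟩
    · exact h
    · rw [hroot] at h; simp at h
  | append_singleton u z ih =>
    have h : (tree d).Adj (g.1 (u ++ [z])) (g.1 (u ++ [z] ++ [x])) :=
      g.1.map_rel_iff.2 (Or.inl ⟨x, rfl⟩)
    rcases h with h | ⟨y, h⟩
    · exact h
    · exfalso
      obtain ⟨z', hz'⟩ := ih z
      rw [hz'] at h
      have h2 := g.1.injective (List.append_inj_left' h rfl)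
      simpa using congrArg List.length h2

theorem prefix_exists {d : ℕ} (g : autTree d) (u v : List (Fin d)) :
    ∃ w, g.1 (u ++ v) = g.1 u ++ w ∧ w.length = v.length := by
  induction v using List.reverseRecOn with
  | nil => exact ⟨[], by simp⟩
  | append_singleton v x ih =>
    obtain ⟨w, hw, hl⟩ := ih
    obtain ⟨y, hy⟩ := child_of_child g (u ++ v) x
    exact ⟨w ++ [y], by rw [← List.append_assoc, hy, hw, List.append_assoc], by simp [hl]⟩

theorem length_apply {d : ℕ} (g : autTree d) (u : List (Fin d)) :
    (g.1 u).length = u.length := by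
  obtain ⟨w, hw, hl⟩ := prefix_exists g [] u
  have hroot : g.1 [] = [] := g.2
  rw [hroot] at hw
  simpa [hl] using congrArg List.length hw

/-- The underlying map of the section `g|_u`: it sends `v` to the word `v'` with
`g (u ++ v) = g u ++ v'`. -/
def sectionFun {d : ℕ} (g : autTree d) (u v : List (Fin d)) : List (Fin d) :=
  (g.1 (u ++ v)).drop u.length

theorem apply_append {d : ℕ} (g : autTree d) (u v : List (Fin d)) :
    g.1 (u ++ v) = g.1 u ++ sectionFun g u v := by
  obtain ⟨w, hw, -⟩ := prefix_exists g u v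
  rw [sectionFun, hw, ← length_apply g u, List.drop_left]

theorem sectionFun_eq {d : ℕ} (g : autTree d) {u v w : List (Fin d)}
    (h : g.1 (u ++ v) = g.1 u ++ w) : sectionFun g u v = w := by
  rw [apply_append] at h
  exact List.append_cancel_left h

/-- A bijection of the vertices which, together with its inverse, fixes the root and maps
children to children is an element of `Aut(T)`. -/
def mkAut {d : ℕ} (e : Equiv.Perm (List (Fin d))) (h0 : e [] = [])
    (h : ∀ u x, ∃ y, e (u ++ [x]) = e u ++ [y])
    (h' : ∀ u x, ∃ y, e.symm (u ++ [x]) = e.symm u ++ [y]) : autTree d :=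
  ⟨{ toEquiv := e
     map_rel_iff' := by
      intro u v
      constructor
      · rintro (⟨x, hx⟩ | ⟨x, hx⟩)
        · obtain ⟨y, hy⟩ := h' (e u) x
          rw [← hx] at hy
          exact Or.inl ⟨y, by simpa using hy⟩
        · obtain ⟨y, hy⟩ := h' (e v) x
          rw [← hx] at hy
          exact Or.inr ⟨y, by simpa using hy⟩
      · rintro (⟨x, rfl⟩ | ⟨x, rfl⟩)
        · exact Or.inl (h u x)
        · exact Or.inr (h v x) }, h0⟩

theorem inv_apply_self {d : ℕ} (g : autTree d) (u : List (Fin d)) :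
    (g⁻¹).1 (g.1 u) = u := g.1.symm_apply_apply u

theorem apply_inv_self {d : ℕ} (g : autTree d) (u : List (Fin d)) :
    g.1 ((g⁻¹).1 u) = u := g.1.apply_symm_apply u

theorem section_child {d : ℕ} (g : autTree d) (u v : List (Fin d)) (x : Fin d) :
    ∃ y, sectionFun g u (v ++ [x]) = sectionFun g u v ++ [y] := by
  obtain ⟨y, hy⟩ := child_of_child g (u ++ v) x
  exact ⟨y, sectionFun_eq g (by
    rw [← List.append_assoc, hy, apply_append, List.append_assoc])⟩

theorem section_left_inv {d : ℕ} (g : autTree d) (u v : List (Fin d)) :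
    sectionFun g⁻¹ (g.1 u) (sectionFun g u v) = v :=
  sectionFun_eq _ (by rw [← apply_append, inv_apply_self, inv_apply_self])

/-- The section `g|_u` as an element of `Aut(T)`. -/
def sect {d : ℕ} (g : autTree d) (u : List (Fin d)) : autTree d :=
  mkAut
    { toFun := sectionFun g u
      invFun := sectionFun g⁻¹ (g.1 u)
      left_inv := section_left_inv g u
      right_inv := fun v => by
        have h := section_left_inv g⁻¹ (g.1 u) v
        rwa [inv_inv, inv_apply_self] at h }
    (sectionFun_eq g (by simp))
    (section_child g u)
    (section_child g⁻¹ (g.1 u))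

theorem sect_eq {d : ℕ} {g : autTree d} {u : List (Fin d)} {h : autTree d}
    (H : ∀ v, g.1 (u ++ v) = g.1 u ++ h.1 v) : sect g u = h := by
  apply Subtype.ext
  apply RelIso.ext
  intro v
  exact sectionFun_eq g (H v)

theorem apply_append_sect {d : ℕ} (g : autTree d) (u v : List (Fin d)) :
    g.1 (u ++ v) = g.1 u ++ (sect g u).1 v := apply_append g u v

theorem sect_one {d : ℕ} (u : List (Fin d)) : sect (1 : autTree d) u = 1 :=
  sect_eq fun _ => rfl

theorem sect_mul {d : ℕ} (g h : autTree d) (u : List (Fin d)) :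
    sect (g * h) u = sect g (h.1 u) * sect h u :=
  sect_eq fun v => by
    change g.1 (h.1 (u ++ v)) = g.1 (h.1 u) ++ (sect g (h.1 u)).1 ((sect h u).1 v)
    rw [apply_append_sect h, apply_append_sect g]

theorem sect_inv {d : ℕ} (g : autTree d) (u : List (Fin d)) :
    sect g⁻¹ u = (sect g ((g⁻¹).1 u))⁻¹ := by
  have h := sect_mul g g⁻¹ u
  rw [mul_inv_cancel, sect_one] at h
  exact (inv_eq_of_mul_eq_one_right h.symm).symm

theorem sect_append {d : ℕ} (g : autTree d) (u v : List (Fin d)) :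
    sect g (u ++ v) = sect (sect g u) v :=
  sect_eq fun w => by
    rw [List.append_assoc, apply_append_sect g u, apply_append_sect (sect g u) v,
      apply_append_sect g u v, List.append_assoc]

/-- The cyclic successor `i ↦ i + 1 (mod d)` on the letters. -/
def next {d : ℕ} (i : Fin d) : Fin d := ⟨(i.val + 1) % d, Nat.mod_lt _ i.pos⟩

/-- The generator `a_i`: it swaps the letters `i` and `i + 1 (mod d)` at the root, its section at
`i` is `a_i`, its section at `i + 1` is `a_{i+1}`, and its other sections are trivial. -/
def genFun {d : ℕ} : Fin d → List (Fin d) → List (Fin d)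
  | _, [] => []
  | i, x :: v =>
    if x = i then next i :: genFun i v
    else if x = next i then i :: genFun (next i) v
    else x :: v

/-- The inverse of `genFun i`. -/
def genInv {d : ℕ} : Fin d → List (Fin d) → List (Fin d)
  | _, [] => []
  | i, x :: v =>
    if x = next i then i :: genInv i v
    else if x = i then next i :: genInv (next i) v
    else x :: v

theorem genInv_genFun {d : ℕ} (i : Fin d) (v : List (Fin d)) : genInv i (genFun i v) = v := by
  induction v generalizing i with
  | nil => rfl
  | cons x v ih =>
    by_cases h : x = i
    · simp [genFun, genInv, h, ih]
    · by_cases h2 : x = next i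
      · have h3 : i ≠ next i := fun h3 => h (h2.trans h3.symm)
        simp [genFun, genInv, h2, h3, h3.symm, ih]
      · simp [genFun, genInv, h, h2]

theorem genFun_genInv {d : ℕ} (i : Fin d) (v : List (Fin d)) : genFun i (genInv i v) = v := by
  induction v generalizing i with
  | nil => rfl
  | cons x v ih =>
    by_cases h : x = next i
    · simp [genFun, genInv, h, ih]
    · by_cases h2 : x = i
      · have h3 : next i ≠ i := fun h3 => h (h2.trans h3.symm)
        simp [genFun, genInv, h2, h3, h3.symm, ih]
      · simp [genFun, genInv, h, h2]

theorem genFun_child {d : ℕ} (i : Fin d) (u : List (Fin d)) (x : Fin d) :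
    ∃ y, genFun i (u ++ [x]) = genFun i u ++ [y] := by
  induction u generalizing i with
  | nil => simp only [List.nil_append, genFun]; split_ifs <;> exact ⟨_, rfl⟩
  | cons z u ih =>
    obtain ⟨y, hy⟩ := ih i
    obtain ⟨y', hy'⟩ := ih (next i)
    simp only [List.cons_append, genFun]
    split_ifs
    · exact ⟨y, by rw [hy, List.cons_append]⟩
    · exact ⟨y', by rw [hy', List.cons_append]⟩
    · exact ⟨x, rfl⟩

theorem genInv_child {d : ℕ} (i : Fin d) (u : List (Fin d)) (x : Fin d) :
    ∃ y, genInv i (u ++ [x]) = genInv i u ++ [y] := by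
  induction u generalizing i with
  | nil => simp only [List.nil_append, genInv]; split_ifs <;> exact ⟨_, rfl⟩
  | cons z u ih =>
    obtain ⟨y, hy⟩ := ih i
    obtain ⟨y', hy'⟩ := ih (next i)
    simp only [List.cons_append, genInv]
    split_ifs
    · exact ⟨y, by rw [hy, List.cons_append]⟩
    · exact ⟨y', by rw [hy', List.cons_append]⟩
    · exact ⟨x, rfl⟩

/-- The generator `a_i` as an element of `Aut(T)`. -/
def gen {d : ℕ} (i : Fin d) : autTree d :=
  mkAut ⟨genFun i, genInv i, genInv_genFun i, genFun_genInv i⟩ rfl (genFun_child i)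
    (genInv_child i)

/-- The group `G_d`, generated by `a_1, …, a_d`. -/
def G (d : ℕ) : Subgroup (autTree d) := Subgroup.closure (Set.range gen)

theorem gen_mem {d : ℕ} (i : Fin d) : gen i ∈ G d := Subgroup.subset_closure ⟨i, rfl⟩

theorem sect_gen_mem {d : ℕ} (i : Fin d) (u : List (Fin d)) : sect (gen i) u ∈ G d := by
  induction u generalizing i with
  | nil =>
    have h : sect (gen i) [] = gen i := sect_eq fun _ => rfl
    rw [h]; exact gen_mem i
  | cons x u ih =>
    rw [← List.singleton_append, sect_append]
    by_cases h : x = i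
    · have : sect (gen i) [x] = gen i := sect_eq fun v => by
        change genFun i (x :: v) = genFun i [x] ++ genFun i v
        simp [genFun, h]
      rw [this]; exact ih i
    · by_cases h2 : x = next i
      · have : sect (gen i) [x] = gen (next i) := sect_eq fun v => by
          change genFun i (x :: v) = genFun i [x] ++ genFun (next i) v
          rw [genFun, genFun, if_neg h, if_pos h2, if_neg h, if_pos h2]; rfl
        rw [this]; exact ih (next i)
      · have : sect (gen i) [x] = 1 := sect_eq fun v => by
          change genFun i (x :: v) = genFun i [x] ++ v
          rw [genFun, genFun, if_neg h, if_neg h2, if_neg h, if_neg h2]; rfl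
        rw [this, sect_one]; exact one_mem _

/-- `G_d` is self-similar. -/
theorem sect_mem {d : ℕ} {g : autTree d} (hg : g ∈ G d) (u : List (Fin d)) : sect g u ∈ G d := by
  induction hg using Subgroup.closure_induction generalizing u with
  | mem g hg => obtain ⟨i, rfl⟩ := hg; exact sect_gen_mem i u
  | one => rw [sect_one]; exact one_mem _
  | mul g h _ _ ihg ihh => rw [sect_mul]; exact mul_mem (ihg _) (ihh _)
  | inv g _ ih => rw [sect_inv]; exact inv_mem (ih _)

/-- The `k`-th level stabilizer `St(k)` in `G_d`. -/
def levelStab (d k : ℕ) : Subgroup (G d) where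
  carrier := {g | ∀ u : List (Fin d), u.length = k → g.1.1 u = u}
  one_mem' := fun _ _ => rfl
  mul_mem' {g h} hg hh := fun u hu => by
    change g.1.1 (h.1.1 u) = u
    rw [hh u hu, hg u hu]
  inv_mem' {g} hg := fun u hu => by
    have h := inv_apply_self g.1 u
    rwa [hg u hu] at h

/-- The vertices of level `k` in lexicographic order: for `0 ≤ m < d ^ k` this is the word whose
letters are the `k` base-`d` digits of `m`, the most significant one first. -/
def levelVertex (d : ℕ) : (k : ℕ) → Fin (d ^ k) → List (Fin d)
  | 0, _ => []
  | k + 1, m =>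
    let m' : Fin (d ^ k * d) := Fin.cast (pow_succ d k) m
    levelVertex d k m'.divNat ++ [m'.modNat]

theorem length_levelVertex (d k : ℕ) (m : Fin (d ^ k)) : (levelVertex d k m).length = k := by
  induction k with
  | zero => rfl
  | succ k ih => simp [levelVertex, ih]

/-- The homomorphism `ψ_k : St(k) → G_d × ⋯ × G_d` (`d ^ k` factors), which sends `g` to the tuple
of its sections at the vertices of level `k`, in lexicographic order. -/
def psi (d k : ℕ) : levelStab d k →* (Fin (d ^ k) → G d) where
  toFun g m := ⟨sect g.1.1 (levelVertex d k m), sect_mem g.1.2 _⟩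
  map_one' := funext fun _ => Subtype.ext (sect_one _)
  map_mul' g h := funext fun m => Subtype.ext (by
    change sect (g.1.1 * h.1.1) _ = sect g.1.1 _ * sect h.1.1 _
    rw [sect_mul, h.2 _ (length_levelVertex d k m)])

/-- Words over the letters `a_1, …, a_d` and their formal inverses; `(i, true)` stands for `a_i`
and `(i, false)` for `a_i⁻¹`. -/
abbrev Word (d : ℕ) : Type := List (Fin d × Bool)

/-- The element of `G_d` that a letter represents. -/
def letterVal {d : ℕ} (l : Fin d × Bool) : G d :=
  if l.2 then ⟨gen l.1, gen_mem l.1⟩ else ⟨gen l.1, gen_mem l.1⟩⁻¹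

/-- The element of `G_d` that a word represents. A product written from left to right acts on the
tree with its leftmost factor first. -/
def wordVal {d : ℕ} : Word d → G d
  | [] => 1
  | l :: w => wordVal w * letterVal l

/-- `|w|_p`, the exponent sum of the letter `a_p` in the word `w`. -/
def wordExp {d : ℕ} (p : Fin d) (w : Word d) : ℤ :=
  (w.map fun l => if l.1 = p then (if l.2 then 1 else -1) else 0).sum

/-- `|w|_A`, the sum of the exponent sums of all letters in the word `w`. -/
def wordExpA {d : ℕ} (w : Word d) : ℤ := ∑ p, wordExp p w

theorem wordVal_append {d : ℕ} (v w : Word d) : wordVal (v ++ w) = wordVal w * wordVal v := by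
  induction v with
  | nil => simp [wordVal]
  | cons l v ih => simp [wordVal, ih, mul_assoc]

theorem exists_inv_word {d : ℕ} (w : Word d) : ∃ v : Word d, wordVal v = (wordVal w)⁻¹ := by
  induction w with
  | nil => exact ⟨[], by simp [wordVal]⟩
  | cons l w ih =>
    obtain ⟨v, hv⟩ := ih
    refine ⟨v ++ [(l.1, !l.2)], ?_⟩
    rw [wordVal_append, hv]
    cases h : l.2 <;> simp [wordVal, letterVal, h]

theorem exists_word {d : ℕ} (g : G d) : ∃ w : Word d, wordVal w = g := by
  obtain ⟨g, hg⟩ := g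
  induction hg using Subgroup.closure_induction with
  | mem g hg =>
    obtain ⟨i, rfl⟩ := hg
    exact ⟨[(i, true)], by simp [wordVal, letterVal]⟩
  | one => exact ⟨[], rfl⟩
  | mul g h hg hh ihg ihh =>
    obtain ⟨v, hv⟩ := ihg
    obtain ⟨w, hw⟩ := ihh
    exact ⟨w ++ v, by rw [wordVal_append, hv, hw]; rfl⟩
  | inv g hg ih =>
    obtain ⟨v, hv⟩ := ih
    obtain ⟨w, hw⟩ := exists_inv_word v
    exact ⟨w, by rw [hw, hv]; rfl⟩

/-- `|g|_A` for `g ∈ G_d`: the exponent sum `|w|_A` of a word `w` that represents `g`. (That it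
does not depend on the word is part of the theorem.) -/
noncomputable def expA {d : ℕ} (g : G d) : ℤ := wordExpA (exists_word g).choose

/-- The index `d ^ r * t + i` of a `d ^ k`-tuple, where `r ≤ k`, `0 ≤ t < d ^ (k - r)` and
`0 ≤ i < d ^ r` (all indices start at `0`). -/
def blockIndex {d k r : ℕ} (hr : r ≤ k) (t : Fin (d ^ (k - r))) (i : Fin (d ^ r)) : Fin (d ^ k) :=
  ⟨d ^ r * t + i, by
    calc d ^ r * t.val + i.val < d ^ r * t.val + d ^ r := Nat.add_lt_add_left i.isLt _
      _ = d ^ r * (t.val + 1) := by ring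
      _ ≤ d ^ r * d ^ (k - r) := Nat.mul_le_mul_left _ t.isLt
      _ = d ^ k := by rw [← pow_add, Nat.add_sub_cancel' hr]⟩

end TreeGroup

namespace TreeGroup

/-! Exponent sum. A generator leaves a letter of the same sign in exactly two first-level sections,
so the lengths and the exponent sums of the sections of a word add up to twice those of the word.
Take a shortest word that is trivial in the group and has nonzero exponent sum, with that sum as
large as possible in absolute value. Its sections are trivial too, so exactly two are nonempty, both
of full length and with the same exponent sum. Two full sections force all letters to have one
index. One such section is again extremal, hence also has one index, and this makes the signs of the
original word alternate. Its exponent sum is then 0 or ±1, but it is even because the word acts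
trivially on the first level (`wordExpA_eq_zero`).

First level. A tuple `s` is the tuple of sections of a first-level stabilizer element iff 4 divides
the total exponent sum (`mem_sectionTuples_iff`). Necessity: that total is twice the exponent sum of
the element, which is even. For sufficiency, the group is self-replicating (`exists_step`), so the
elements that can occur alone at one letter form a normal subgroup independent of the letter. A
braid relator identifies `a_i` with `a_{i+2}` modulo it, hence all generators, since `d` is odd. So
it contains all elements of exponent sum 0, and only exponent sums matter. Squares of generators,
and comparison of the two ways round the cycle to swap adjacent letters, show that every integer
vector with sum divisible by 4 occurs.

Level `k`. A tuple on level `k + 1` is realizable iff its families of siblings are section tuples of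
elements forming a realizable tuple on level `k`. Passing up a level halves the block sums, which
turns the condition for `r + 1` into the one for `r`. The condition for `r = 1` is the first-level
criterion. -/

/-! ### Sections at a single letter -/

/-- `Step g x y s`: the element `g` sends the letter `x` to `y`, with section `s` at `x`. -/
def Step {d : ℕ} (g : G d) (x y : Fin d) (s : G d) : Prop :=
  ∀ v, g.1.1 (x :: v) = y :: s.1.1 v

/-- The generator `a_i` as an element of `G d`. -/
def genG {d : ℕ} (i : Fin d) : G d := ⟨gen i, gen_mem i⟩

namespace Step

variable {d : ℕ} {g h s t : G d} {x y z : Fin d}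

theorem one (x : Fin d) : Step (1 : G d) x x 1 := fun _ => rfl

theorem mul (hg : Step g y z t) (hh : Step h x y s) : Step (g * h) x z (t * s) := fun v => by
  change g.1.1 (h.1.1 (x :: v)) = z :: t.1.1 (s.1.1 v)
  rw [hh, hg]

theorem inv (hg : Step g x y s) : Step g⁻¹ y x s⁻¹ := fun v => by
  have h1 := hg ((s⁻¹).1.1 v)
  have h2 : s.1.1 ((s⁻¹).1.1 v) = v := apply_inv_self s.1 v
  rw [h2] at h1
  rw [← h1]
  exact inv_apply_self g.1 _

theorem target_unique (h1 : Step g x y s) (h2 : Step g x z t) : y = z := by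
  have h := (h1 []).symm.trans (h2 [])
  exact (List.cons.inj h).1

theorem section_unique (h1 : Step g x y s) (h2 : Step g x z t) : s = t := by
  apply Subtype.ext
  apply Subtype.ext
  apply RelIso.ext
  intro v
  exact (List.cons.inj ((h1 v).symm.trans (h2 v))).2

theorem exists_of (g : G d) (x : Fin d) : ∃ y s, Step g x y s := by
  obtain ⟨y, hy⟩ := List.length_eq_one_iff.1 (length_apply g.1 [x])
  exact ⟨y, ⟨sect g.1 [x], sect_mem g.2 _⟩, fun v => by
    have h := apply_append_sect g.1 [x] v
    rw [hy] at h
    exact h⟩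

theorem exists_source (g : G d) (y : Fin d) : ∃ x s, Step g x y s := by
  obtain ⟨x, s, h⟩ := exists_of g⁻¹ y
  exact ⟨x, s⁻¹, by simpa using h.inv⟩

theorem gen_self (i : Fin d) : Step (genG i) i (next i) (genG i) := fun v => by
  change genFun i (i :: v) = next i :: genFun i v
  simp [genFun]

theorem gen_next {i : Fin d} (hi : next i ≠ i) : Step (genG i) (next i) i (genG (next i)) :=
  fun v => by
    change genFun i (next i :: v) = i :: genFun (next i) v
    simp [genFun, hi]

theorem gen_other {i x : Fin d} (h1 : x ≠ i) (h2 : x ≠ next i) : Step (genG i) x x 1 :=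
  fun v => by
    change genFun i (x :: v) = x :: v
    simp [genFun, h1, h2]

end Step

/-! ### The cyclic successor -/

theorem val_next_iterate {d : ℕ} (j : ℕ) (x : Fin d) : ((next^[j] x) : ℕ) = (x + j) % d := by
  induction j with
  | zero => simp [Nat.mod_eq_of_lt x.isLt]
  | succ j ih => rw [Function.iterate_succ_apply', next]; simp [ih, add_assoc]

theorem next_iterate_ne {d j : ℕ} (hj : 0 < j) (hjd : j < d) (x : Fin d) : next^[j] x ≠ x := by
  intro h
  have h1 := val_next_iterate j x
  rw [h] at h1
  have hx := x.isLt
  rcases lt_or_ge (x + j : ℕ) d with h2 | h2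
  · rw [Nat.mod_eq_of_lt h2] at h1; omega
  · rw [Nat.mod_eq_sub_mod h2, Nat.mod_eq_of_lt (by omega)] at h1; omega

theorem next_iterate_card {d : ℕ} (x : Fin d) : next^[d] x = x := by
  apply Fin.ext
  rw [val_next_iterate]
  simp [Nat.mod_eq_of_lt x.isLt]

theorem next_ne {d : ℕ} (hd : 3 ≤ d) (x : Fin d) : next x ≠ x :=
  next_iterate_ne (j := 1) one_pos (by omega) x

theorem next_next_ne {d : ℕ} (hd : 3 ≤ d) (x : Fin d) : next (next x) ≠ x :=
  next_iterate_ne (j := 2) two_pos (by omega) x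

theorem exists_iterate_eq {d : ℕ} (x y : Fin d) : ∃ j, next^[j] x = y := by
  refine ⟨y + (d - x), Fin.ext ?_⟩
  rw [val_next_iterate, show (x : ℕ) + (y + (d - x)) = y + d by omega]
  simp [Nat.mod_eq_of_lt y.isLt]

theorem eq_of_next {d : ℕ} {α : Type*} {F : Fin d → α} (hF : ∀ x, F (next x) = F x)
    (x y : Fin d) : F x = F y := by
  obtain ⟨j, rfl⟩ := exists_iterate_eq x y
  induction j with
  | zero => rfl
  | succ j ih => rw [Function.iterate_succ_apply', hF, ih]

/-- On a cycle of odd length, a function that is invariant under two steps is constant. -/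
theorem eq_of_next_next {d : ℕ} (hodd : Odd d) {α : Type*} {F : Fin d → α}
    (hF : ∀ x, F (next (next x)) = F x) (x y : Fin d) : F x = F y := by
  refine eq_of_next (fun x => ?_) x y
  have key : ∀ n : ℕ, F (next^[2 * n] x) = F x := by
    intro n
    induction n with
    | zero => rfl
    | succ n ih =>
      rw [show 2 * (n + 1) = 2 * n + 1 + 1 by ring, Function.iterate_succ_apply',
        Function.iterate_succ_apply', hF, ih]
  obtain ⟨m, hm⟩ := hodd
  -- With `d = 2m + 1`, an even number `2(m + 1) = d + 1` of steps amounts to a single step.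
  have h := key (m + 1)
  rwa [show 2 * (m + 1) = d + 1 by omega, Function.iterate_succ_apply', next_iterate_card] at h

/-! ### Sections of words -/

/-- The exponent of a letter. -/
def letterSign {d : ℕ} (l : Fin d × Bool) : ℤ := if l.2 then 1 else -1

theorem wordExpA_nil {d : ℕ} : wordExpA ([] : Word d) = 0 := by simp [wordExpA, wordExp]

theorem wordExpA_cons {d : ℕ} (l : Fin d × Bool) (w : Word d) :
    wordExpA (l :: w) = letterSign l + wordExpA w := by
  simp [wordExpA, wordExp, Finset.sum_add_distrib, letterSign]

theorem wordExpA_append {d : ℕ} (v w : Word d) :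
    wordExpA (v ++ w) = wordExpA v + wordExpA w := by
  induction v with
  | nil => simp [wordExpA_nil]
  | cons l v ih => rw [List.cons_append, wordExpA_cons, wordExpA_cons, ih, add_assoc]

theorem abs_wordExpA_le {d : ℕ} (w : Word d) : (wordExpA w).natAbs ≤ w.length := by
  induction w with
  | nil => simp [wordExpA_nil]
  | cons l w ih =>
    rw [wordExpA_cons, List.length_cons]
    unfold letterSign
    split_ifs <;> omega

/-- The section of a letter, as a word of length at most one. -/
def letterSec {d : ℕ} (l : Fin d × Bool) (x : Fin d) : Word d :=
  if x = l.1 then [(if l.2 then l.1 else next l.1, l.2)]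
  else if x = next l.1 then [(if l.2 then next l.1 else l.1, l.2)]
  else []

/-- The permutation of the first level that a word induces. -/
def wordPerm {d : ℕ} : Word d → Equiv.Perm (Fin d)
  | [] => 1
  | l :: w => wordPerm w * Equiv.swap l.1 (next l.1)

/-- The section of a word at a letter. -/
def wordSec {d : ℕ} : Word d → Fin d → Word d
  | [], _ => []
  | l :: w, x => letterSec l x ++ wordSec w (Equiv.swap l.1 (next l.1) x)

/-- Since `a_i` carries `i + 1` to `i`, the section of its inverse at `i` inverts the section of
`a_i` at `i + 1`; hence the exchanged indices for negative letters. -/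
theorem step_letterVal {d : ℕ} (hd : 3 ≤ d) (l : Fin d × Bool) (x : Fin d) :
    Step (letterVal l) x (Equiv.swap l.1 (next l.1) x) (wordVal (letterSec l x)) := by
  obtain ⟨i, b⟩ := l
  have hn := next_ne hd i
  by_cases h1 : x = i
  · subst h1
    cases b
    · simpa [letterSec, letterVal, wordVal, genG] using (Step.gen_next hn).inv
    · simpa [letterSec, letterVal, wordVal, genG] using Step.gen_self x
  · by_cases h2 : x = next i
    · subst h2
      cases b
      · simpa [letterSec, letterVal, wordVal, genG, hn] using (Step.gen_self i).inv
      · simpa [letterSec, letterVal, wordVal, genG, hn] using Step.gen_next hn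
    · rw [Equiv.swap_apply_of_ne_of_ne h1 h2]
      cases b
      · simpa [letterSec, letterVal, wordVal, genG, h1, h2] using (Step.gen_other h1 h2).inv
      · simpa [letterSec, letterVal, wordVal, genG, h1, h2] using Step.gen_other h1 h2

theorem step_wordVal {d : ℕ} (hd : 3 ≤ d) (w : Word d) (x : Fin d) :
    Step (wordVal w) x (wordPerm w x) (wordVal (wordSec w x)) := by
  induction w generalizing x with
  | nil => exact Step.one x
  | cons l w ih =>
    rw [wordSec, wordVal_append]
    exact (ih _).mul (step_letterVal hd l x)

theorem sum_ite_letter {d : ℕ} (hd : 3 ≤ d) {M : Type*} [AddCommMonoid M] (i : Fin d) (c : M) :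
    ∑ x, (if x = i then c else if x = next i then c else 0) = 2 • c := by
  have hn := next_ne hd i
  have h : ∀ x, (if x = i then c else if x = next i then c else 0)
      = (if x = i then c else 0) + (if x = next i then c else 0) := by
    intro x
    by_cases h1 : x = i
    · simp [h1, hn.symm]
    · simp [h1]
  simp only [h, Finset.sum_add_distrib, Finset.sum_ite_eq', Finset.mem_univ, if_true, two_nsmul]

/-- Each letter of the word contributes a letter of its own sign to exactly two sections. What
follows it is only permuted among the first-level letters. -/
theorem sum_wordExpA_wordSec {d : ℕ} (hd : 3 ≤ d) (w : Word d) :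
    ∑ x, wordExpA (wordSec w x) = 2 * wordExpA w := by
  induction w with
  | nil => simp [wordSec, wordExpA_nil]
  | cons l w ih =>
    simp only [wordSec, wordExpA_append, wordExpA_cons, Finset.sum_add_distrib]
    rw [Equiv.sum_comp (Equiv.swap l.1 (next l.1)) (fun x => wordExpA (wordSec w x)), ih, mul_add]
    congr 1
    have h := sum_ite_letter hd l.1 (letterSign l)
    rw [two_nsmul, ← two_mul] at h
    rw [← h]
    refine Finset.sum_congr rfl fun x _ => ?_
    unfold letterSec
    split_ifs <;> simp_all [wordExpA_cons, wordExpA_nil, letterSign]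

theorem sum_length_wordSec {d : ℕ} (hd : 3 ≤ d) (w : Word d) :
    ∑ x, (wordSec w x).length = 2 * w.length := by
  induction w with
  | nil => simp [wordSec]
  | cons l w ih =>
    simp only [wordSec, List.length_append, List.length_cons, Finset.sum_add_distrib]
    rw [Equiv.sum_comp (Equiv.swap l.1 (next l.1)) (fun x => (wordSec w x).length), ih, mul_add,
      add_comm]
    congr 1
    have h := sum_ite_letter hd l.1 1
    rw [← smul_eq_mul, ← h]
    refine Finset.sum_congr rfl fun x _ => ?_
    unfold letterSec
    split_ifs <;> rfl

theorem length_wordSec_le {d : ℕ} (w : Word d) (x : Fin d) :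
    (wordSec w x).length ≤ w.length := by
  induction w generalizing x with
  | nil => simp [wordSec]
  | cons l w ih =>
    have h := ih (Equiv.swap l.1 (next l.1) x)
    have h' : (letterSec l x).length ≤ 1 := by unfold letterSec; split_ifs <;> simp
    simp only [wordSec, List.length_append, List.length_cons]
    omega

/-- Every letter acts on the first level as a transposition. -/
theorem sign_wordPerm {d : ℕ} (hd : 3 ≤ d) (w : Word d) :
    Equiv.Perm.sign (wordPerm w) = (wordExpA w).negOnePow := by
  induction w with
  | nil => simp [wordPerm, wordExpA_nil]
  | cons l w ih =>
    rw [wordPerm, map_mul, ih, Equiv.Perm.sign_swap (next_ne hd _).symm, wordExpA_cons,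
      Int.negOnePow_add, mul_comm]
    congr 1
    unfold letterSign
    split_ifs <;> simp

theorem even_wordExpA {d : ℕ} (hd : 3 ≤ d) {w : Word d} (h : ∀ x, ∃ s, Step (wordVal w) x x s) :
    Even (wordExpA w) := by
  have h1 : wordPerm w = 1 := by
    ext1 x
    obtain ⟨s, hs⟩ := h x
    exact (step_wordVal hd w x).target_unique hs
  have h2 := sign_wordPerm hd w
  rw [h1, map_one] at h2
  exact (Int.negOnePow_eq_one_iff _).1 h2.symm

/-! ### Trivial words have exponent sum zero -/

theorem full_length_cons {d : ℕ} {l : Fin d × Bool} {w : Word d} {x : Fin d}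
    (h : (wordSec (l :: w) x).length = (l :: w).length) :
    (x = l.1 ∨ x = next l.1) ∧
      (wordSec w (Equiv.swap l.1 (next l.1) x)).length = w.length := by
  have h1 := length_wordSec_le w (Equiv.swap l.1 (next l.1) x)
  simp only [wordSec, List.length_append, List.length_cons, letterSec] at h
  by_cases h2 : x = l.1
  · rw [if_pos h2, List.length_singleton] at h
    exact ⟨Or.inl h2, by omega⟩
  · by_cases h3 : x = next l.1
    · rw [if_neg h2, if_pos h3, List.length_singleton] at h
      exact ⟨Or.inr h3, by omega⟩
    · rw [if_neg h2, if_neg h3, List.length_nil] at h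
      omega

/-- If two sections of a word have full length, all its letters swap the same two points. -/
theorem letters_of_two_full {d : ℕ} {w : Word d} {x y : Fin d} (hxy : x ≠ y)
    (hx : (wordSec w x).length = w.length) (hy : (wordSec w y).length = w.length) :
    ∀ l ∈ w, (x = l.1 ∧ y = next l.1) ∨ (x = next l.1 ∧ y = l.1) := by
  induction w generalizing x y with
  | nil => simp
  | cons l w ih =>
    obtain ⟨h1, h2⟩ := full_length_cons hx
    obtain ⟨h3, h4⟩ := full_length_cons hy
    have key : (x = l.1 ∧ y = next l.1) ∨ (x = next l.1 ∧ y = l.1) := by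
      rcases h1 with h1 | h1 <;> rcases h3 with h3 | h3
      · exact absurd (h1.trans h3.symm) hxy
      · exact Or.inl ⟨h1, h3⟩
      · exact Or.inr ⟨h1, h3⟩
      · exact absurd (h1.trans h3.symm) hxy
    intro l' hl'
    rcases List.mem_cons.1 hl' with rfl | hl'
    · exact key
    · have hsx : Equiv.swap l.1 (next l.1) x = y := by
        rcases key with ⟨rfl, rfl⟩ | ⟨rfl, rfl⟩ <;> simp
      have hsy : Equiv.swap l.1 (next l.1) y = x := by rw [← hsx, Equiv.swap_apply_self]
      rw [hsx] at h2
      rw [hsy] at h4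
      rcases ih hxy.symm h2 h4 l' hl' with h | h
      · exact Or.inr h.symm
      · exact Or.inl h.symm

/-- For `d ≥ 3` the pair `{i, i + 1}` determines `i`. -/
theorem same_index_of_two_full {d : ℕ} (hd : 3 ≤ d) {w : Word d} {x y : Fin d} (hxy : x ≠ y)
    (hx : (wordSec w x).length = w.length) (hy : (wordSec w y).length = w.length)
    {l l' : Fin d × Bool} (hl : l ∈ w) (hl' : l' ∈ w) : l'.1 = l.1 := by
  rcases letters_of_two_full hxy hx hy l hl with h | h <;>
    rcases letters_of_two_full hxy hx hy l' hl' with h' | h'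
  · rw [← h.1, ← h'.1]
  · exact absurd (by rw [← h.2, h'.2, ← h'.1, h.1]) (next_next_ne hd l.1)
  · exact absurd (by rw [← h'.2, h.2, ← h.1, h'.1]) (next_next_ne hd l'.1)
  · rw [← h.2, ← h'.2]

/-- If all letters of a word and all letters of one of its nontrivial sections have a single
index, the signs of the word alternate. -/
theorem wordExpA_of_same_index {d : ℕ} (hd : 3 ≤ d) {i j : Fin d} {w : Word d} {x : Fin d}
    (hx : x = i ∨ x = next i) (hw : ∀ l ∈ w, l.1 = i) (hs : ∀ l ∈ wordSec w x, l.1 = j) :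
    (x = j → wordExpA w = 0 ∨ wordExpA w = 1) ∧
      (x ≠ j → wordExpA w = 0 ∨ wordExpA w = -1) := by
  have hn := next_ne hd i
  induction w generalizing x with
  | nil => simp [wordExpA_nil]
  | cons l w ih =>
    obtain ⟨i', b⟩ := l
    obtain rfl : i' = i := hw _ List.mem_cons_self
    have hw' : ∀ l ∈ w, l.1 = i' := fun l hl => hw l (List.mem_cons_of_mem _ hl)
    have hs' : ∀ l ∈ wordSec w (Equiv.swap i' (next i') x), l.1 = j := fun l hl =>
      hs l (by rw [wordSec]; exact List.mem_append_right _ hl)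
    have hs0 : ∀ l ∈ letterSec (i', b) x, l.1 = j := fun l hl =>
      hs l (by rw [wordSec]; exact List.mem_append_left _ hl)
    rw [wordExpA_cons]
    -- At `i` the letter `a_i` leaves index `i` and its inverse leaves `i + 1`; at `i + 1` it is the
    -- other way round. So `j` dictates each sign, and the sign flips whenever the point crosses: it
    -- is positive exactly when the current point is `j`.
    rcases hx with rfl | rfl
    · rw [Equiv.swap_apply_left] at hs'
      have h := ih (Or.inr rfl) hw' hs'
      cases b
      · have hj : next x = j := by simpa [letterSec] using hs0
        have h1 := h.1 hj
        refine ⟨fun hxj => absurd (hj.trans hxj.symm) hn, fun _ => ?_⟩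
        simp only [letterSign, Bool.false_eq_true, if_false]
        omega
      · have hj : x = j := by simpa [letterSec] using hs0
        have h1 := h.2 (fun h => hn (h.trans hj.symm))
        refine ⟨fun _ => ?_, fun hxj => absurd hj hxj⟩
        simp only [letterSign, if_true]
        omega
    · rw [Equiv.swap_apply_right] at hs'
      have h := ih (Or.inl rfl) hw' hs'
      cases b
      · have hj : i' = j := by simpa [letterSec, hn] using hs0
        have h1 := h.1 hj
        refine ⟨fun hxj => absurd (hxj.trans hj.symm) hn, fun _ => ?_⟩
        simp only [letterSign, Bool.false_eq_true, if_false]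
        omega
      · have hj : next i' = j := by simpa [letterSec, hn] using hs0
        have h1 := h.2 (fun h => hn (hj.trans h.symm))
        refine ⟨fun _ => ?_, fun hxj => absurd hj hxj⟩
        simp only [letterSign, if_true]
        omega

theorem wordVal_wordSec_of_trivial {d : ℕ} (hd : 3 ≤ d) {w : Word d} (hw : wordVal w = 1)
    (x : Fin d) : wordVal (wordSec w x) = 1 := by
  have h := step_wordVal hd w x
  rw [hw] at h
  exact h.section_unique (Step.one x)

/-- In a shortest counterexample with the largest exponent sum, two sections have full length and
the same exponent sum. -/
theorem exists_two_full {d : ℕ} (hd : 3 ≤ d) {w : Word d} (hw : wordVal w = 1)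
    (hn : wordExpA w ≠ 0)
    (ih1 : ∀ v : Word d, wordVal v = 1 → v.length < w.length → wordExpA v = 0)
    (ih2 : ∀ v : Word d, wordVal v = 1 → v.length = w.length →
      (wordExpA w).natAbs < (wordExpA v).natAbs → wordExpA v = 0) :
    ∃ x y, x ≠ y ∧ (wordSec w x).length = w.length ∧ (wordSec w y).length = w.length ∧
      wordExpA (wordSec w x) = wordExpA w := by
  have hfull : ∀ x, wordExpA (wordSec w x) ≠ 0 → (wordSec w x).length = w.length := by
    intro x hx
    by_contra hne
    exact hx (ih1 _ (wordVal_wordSec_of_trivial hd hw x)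
      (lt_of_le_of_ne (length_wordSec_le w x) hne))
  have habs : ∀ x, (wordExpA (wordSec w x)).natAbs ≤ (wordExpA w).natAbs := by
    intro x
    by_contra! hlt
    have hx : wordExpA (wordSec w x) ≠ 0 := by
      intro h0
      rw [h0] at hlt
      simp at hlt
    exact hx (ih2 _ (wordVal_wordSec_of_trivial hd hw x) (hfull x hx) hlt)
  have hsum := sum_wordExpA_wordSec hd w
  have hlen := sum_length_wordSec hd w
  obtain ⟨x, -, hx⟩ : ∃ x ∈ Finset.univ, wordExpA (wordSec w x) ≠ 0 := by
    apply Finset.exists_ne_zero_of_sum_ne_zero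
    rw [hsum]
    omega
  rw [← Finset.add_sum_erase _ _ (Finset.mem_univ x)] at hsum hlen
  have hx' := habs x
  -- One section, bounded by `|wordExpA w|`, cannot account for the total `2 * wordExpA w` alone.
  obtain ⟨y, hyx, hy⟩ : ∃ y ∈ Finset.univ.erase x, wordExpA (wordSec w y) ≠ 0 := by
    apply Finset.exists_ne_zero_of_sum_ne_zero
    intro h0
    rw [h0] at hsum
    omega
  rw [← Finset.add_sum_erase _ _ hyx] at hsum hlen
  rw [hfull x hx, hfull y hy] at hlen
  -- Two sections of full length use up the total length `2 * w.length`, so the others are empty.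
  have hrest : ∑ z ∈ (Finset.univ.erase x).erase y, wordExpA (wordSec w z) = 0 := by
    refine Finset.sum_eq_zero fun z hz => ?_
    have h0 : ∑ z ∈ (Finset.univ.erase x).erase y, (wordSec w z).length = 0 := by omega
    have h1 := Finset.sum_eq_zero_iff.1 h0 z hz
    rw [List.length_eq_zero_iff.1 h1, wordExpA_nil]
  rw [hrest] at hsum
  have hy' := habs y
  exact ⟨x, y, (Finset.ne_of_mem_erase hyx).symm, hfull x hx, hfull y hy, by omega⟩

theorem wordExpA_eq_zero {d : ℕ} (hd : 3 ≤ d) {w : Word d} (hw : wordVal w = 1) :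
    wordExpA w = 0 := by
  induction hL : w.length using Nat.strong_induction_on generalizing w with
  | _ L ihL =>
  -- The exponent sum is bounded by the length, so among words of length `L` a larger absolute value
  -- means a smaller `L - (wordExpA w).natAbs`.
  induction hm : L - (wordExpA w).natAbs using Nat.strong_induction_on generalizing w with
  | _ m ihm =>
  have ih1 : ∀ v : Word d, wordVal v = 1 → v.length < L → wordExpA v = 0 :=
    fun v hv hlt => ihL _ hlt hv rfl
  have ih2 : ∀ v : Word d, wordVal v = 1 → v.length = L →
      (wordExpA w).natAbs < (wordExpA v).natAbs → wordExpA v = 0 := by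
    intro v hv hvL hlt
    have h1 := abs_wordExpA_le v
    exact ihm _ (by omega) hv hvL rfl
  by_contra hn
  obtain ⟨x, y, hxy, hx, hy, hE⟩ := exists_two_full hd hw hn (hL ▸ ih1) (hL ▸ ih2)
  -- The section at `x` is trivial with the same length and exponent sum, so it is extremal as well.
  obtain ⟨x', y', hxy', hx', hy', -⟩ := exists_two_full hd
    (wordVal_wordSec_of_trivial hd hw x) (hE ▸ hn) (hx ▸ hL ▸ ih1) (hE ▸ hx ▸ hL ▸ ih2)
  have hpos : 0 < w.length := by
    have := abs_wordExpA_le w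
    omega
  obtain ⟨l, hl⟩ := List.exists_mem_of_length_pos hpos
  obtain ⟨l', hl'⟩ := List.exists_mem_of_length_pos (hx ▸ hpos)
  have hxl : x = l.1 ∨ x = next l.1 :=
    (letters_of_two_full hxy hx hy l hl).imp And.left And.left
  have h := wordExpA_of_same_index hd hxl
    (fun m hm => same_index_of_two_full hd hxy hx hy hl hm)
    (fun m hm => same_index_of_two_full hd hxy' hx' hy' hl' hm)
  have heven : Even (wordExpA w) := even_wordExpA hd fun x => ⟨1, by rw [hw]; exact Step.one x⟩
  obtain ⟨c, hc⟩ := heven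
  by_cases hj : x = l'.1
  · have := h.1 hj; omega
  · have := h.2 hj; omega

/-! ### The exponent sum as a homomorphism on the group -/

theorem exists_inv_word_exp {d : ℕ} (w : Word d) :
    ∃ v : Word d, wordVal v = (wordVal w)⁻¹ ∧ wordExpA v = -wordExpA w := by
  induction w with
  | nil => exact ⟨[], by simp [wordVal], by simp [wordExpA_nil]⟩
  | cons l w ih =>
    obtain ⟨v, hv, he⟩ := ih
    refine ⟨v ++ [(l.1, !l.2)], ?_, ?_⟩
    · rw [wordVal_append, hv]
      cases h : l.2 <;> simp [wordVal, letterVal, h]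
    · rw [wordExpA_append, he, wordExpA_cons, wordExpA_cons, wordExpA_nil]
      cases h : l.2 <;> simp [letterSign, h]

theorem expA_wordVal {d : ℕ} (hd : 3 ≤ d) (w : Word d) : expA (wordVal w) = wordExpA w := by
  have h := (exists_word (wordVal w)).choose_spec
  obtain ⟨v, hv, he⟩ := exists_inv_word_exp w
  have h0 := wordExpA_eq_zero hd (w := v ++ (exists_word (wordVal w)).choose)
    (by rw [wordVal_append, h, hv, mul_inv_cancel])
  rw [wordExpA_append, he] at h0
  unfold expA
  omega

theorem expA_one {d : ℕ} (hd : 3 ≤ d) : expA (1 : G d) = 0 := by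
  rw [← wordExpA_nil (d := d), ← expA_wordVal hd]
  rfl

theorem expA_mul {d : ℕ} (hd : 3 ≤ d) (g h : G d) : expA (g * h) = expA g + expA h := by
  obtain ⟨v, rfl⟩ := exists_word g
  obtain ⟨w, rfl⟩ := exists_word h
  rw [← wordVal_append, expA_wordVal hd, expA_wordVal hd, expA_wordVal hd, wordExpA_append,
    add_comm]

theorem expA_inv {d : ℕ} (hd : 3 ≤ d) (g : G d) : expA g⁻¹ = -expA g := by
  have h := expA_mul hd g⁻¹ g
  rw [inv_mul_cancel, expA_one hd] at h
  omega

theorem expA_genG {d : ℕ} (hd : 3 ≤ d) (i : Fin d) : expA (genG i) = 1 := by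
  have h := expA_wordVal hd [(i, true)]
  simpa [wordVal, letterVal, wordExpA_cons, wordExpA_nil, letterSign, genG] using h

theorem sum_expA_sections {d : ℕ} (hd : 3 ≤ d) {g : G d} {y : Fin d → Fin d} {s : Fin d → G d}
    (h : ∀ x, Step g x (y x) (s x)) : ∑ x, expA (s x) = 2 * expA g := by
  obtain ⟨w, rfl⟩ := exists_word g
  rw [expA_wordVal hd, ← sum_wordExpA_wordSec hd]
  refine Finset.sum_congr rfl fun x _ => ?_
  rw [(h x).section_unique (step_wordVal hd w x), expA_wordVal hd]

theorem even_expA {d : ℕ} (hd : 3 ≤ d) {g : G d} {s : Fin d → G d}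
    (h : ∀ x, Step g x x (s x)) : Even (expA g) := by
  obtain ⟨w, rfl⟩ := exists_word g
  rw [expA_wordVal hd]
  exact even_wordExpA hd fun x => ⟨s x, h x⟩

/-! ### Self-replication -/

/-- For every two letters, each element of `G d` is a section between them. -/
theorem exists_step {d : ℕ} (hd : 3 ≤ d) (hodd : Odd d) (x y : Fin d) (t : G d) :
    ∃ g, Step g x y t := by
  let M : Fin d → Set (G d) := fun z => {s | ∃ g, Step g x z s}
  -- The sets `M z` are cosets of the subgroup `M x`; two of them coincide as soon as they share an
  -- element.
  have hcoset : ∀ {z z' : Fin d} {m q r : G d}, m ∈ M z → q ∈ M z → r ∈ M z' →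
      r * q⁻¹ * m ∈ M z' := by
    rintro z z' m q r ⟨g, hg⟩ ⟨k, hk⟩ ⟨l, hl⟩
    exact ⟨l * k⁻¹ * g, (hl.mul hk.inv).mul hg⟩
  have hup : ∀ z, ∀ s ∈ M z, genG z * s ∈ M (next z) := fun z s ⟨g, hg⟩ =>
    ⟨_, (Step.gen_self z).mul hg⟩
  have hdown : ∀ z, ∀ s ∈ M (next z), genG (next z) * s ∈ M z := fun z s ⟨g, hg⟩ =>
    ⟨_, (Step.gen_next (next_ne hd z)).mul hg⟩
  have htwo : ∀ z, M (next (next z)) = M z := by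
    intro z
    obtain ⟨s, hs⟩ : (M z).Nonempty := by
      have h : (M x).Nonempty := ⟨1, 1, Step.one x⟩
      obtain ⟨j, rfl⟩ := exists_iterate_eq x z
      induction j with
      | zero => exact h
      | succ j ih =>
        obtain ⟨s, hs⟩ := ih
        rw [Function.iterate_succ_apply']
        exact ⟨_, hup _ s hs⟩
    -- The shared element is `a_{z+1} a_z s`: after `a_z`, the generator `a_{z+1}` leads on to `z +
    -- 2`, while a second `a_z` leads back to `z`, with the same section `a_{z+1}`.
    have h1 := hdown z _ (hup z s hs)
    have h2 := hup _ _ (hup z s hs)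
    ext m
    constructor
    · intro hm
      have h := hcoset hm h2 h1
      rwa [mul_inv_cancel, one_mul] at h
    · intro hm
      have h := hcoset hm h1 h2
      rwa [mul_inv_cancel, one_mul] at h
  have hM := eq_of_next_next hodd htwo
  have hgen : ∀ i, genG i ∈ M x := fun i => by
    have h1 : (1 : G d) ∈ M i := hM x i ▸ ⟨1, Step.one x⟩
    have h2 := hup i 1 h1
    rw [mul_one] at h2
    exact hM (next i) x ▸ h2
  have hall : ∀ w : Word d, wordVal w ∈ M x := by
    intro w
    induction w with
    | nil => exact ⟨1, Step.one x⟩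
    | cons l w ih =>
      obtain ⟨g, hg⟩ := ih
      obtain ⟨k, hk⟩ := hgen l.1
      by_cases hl : l.2
      · exact ⟨_, by simpa [wordVal, letterVal, hl, genG] using hg.mul hk⟩
      · exact ⟨_, by simpa [wordVal, letterVal, hl, genG] using hg.mul hk.inv⟩
  obtain ⟨w, rfl⟩ := exists_word t
  change wordVal w ∈ M y
  exact hM x y ▸ hall w

/-! ### The image of the first level stabilizer -/

/-- The tuples of sections of the elements that fix the first level. -/
def sectionTuples (d : ℕ) : Subgroup (Fin d → G d) where
  carrier := {s | ∃ g, ∀ x, Step g x x (s x)}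
  one_mem' := ⟨1, fun x => Step.one x⟩
  mul_mem' := fun ⟨g, hg⟩ ⟨h, hh⟩ => ⟨g * h, fun x => (hg x).mul (hh x)⟩
  inv_mem' := fun ⟨g, hg⟩ => ⟨g⁻¹, fun x => (hg x).inv⟩

/-- The elements `c` for which the tuple with `c` at `x` and trivial other entries is a tuple of
sections. -/
def rigidPart {d : ℕ} (x : Fin d) : Subgroup (G d) :=
  (sectionTuples d).comap (MonoidHom.mulSingle (fun _ : Fin d => G d) x)

theorem mem_rigidPart {d : ℕ} {x : Fin d} {c : G d} :
    c ∈ rigidPart x ↔ ∃ g, Step g x x c ∧ ∀ z, z ≠ x → Step g z z 1 := by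
  constructor
  · rintro ⟨g, hg⟩
    refine ⟨g, by simpa using hg x, fun z hz => ?_⟩
    simpa [Pi.mulSingle_eq_of_ne hz] using hg z
  · rintro ⟨g, hx, hg⟩
    refine ⟨g, fun z => ?_⟩
    by_cases hz : z = x
    · subst hz
      simpa using hx
    · simpa [Pi.mulSingle_eq_of_ne hz] using hg z hz

/-- Conjugation by `k` moves the support from the subtree at `x` to that at `y` and conjugates the
section by `t`. Self-replication allows any `x`, `y`, `t`: `t = 1` gives independence of the letter,
`x = y` gives normality. -/
theorem conj_mem_rigidPart {d : ℕ} {k t c : G d} {x y : Fin d} (hk : Step k x y t)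
    (hc : c ∈ rigidPart x) : t * c * t⁻¹ ∈ rigidPart y := by
  obtain ⟨g, hx, hg⟩ := mem_rigidPart.1 hc
  refine mem_rigidPart.2 ⟨k * g * k⁻¹, (hk.mul hx).mul hk.inv, fun z hz => ?_⟩
  obtain ⟨z', s, hs⟩ := Step.exists_source k z
  have hz' : z' ≠ x := by
    rintro rfl
    exact hz (hs.target_unique hk)
  have h := (hs.mul (hg z' hz')).mul hs.inv
  rwa [mul_one, mul_inv_cancel] at h

theorem rigidPart_eq {d : ℕ} (hd : 3 ≤ d) (hodd : Odd d) (x y : Fin d) :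
    rigidPart x = rigidPart y := by
  have key : ∀ x y : Fin d, rigidPart x ≤ rigidPart y := by
    intro x y c hc
    obtain ⟨k, hk⟩ := exists_step hd hodd x y 1
    simpa using conj_mem_rigidPart hk hc
  exact le_antisymm (key x y) (key y x)

theorem rigidPart_normal {d : ℕ} (hd : 3 ≤ d) (hodd : Odd d) (x : Fin d) :
    (rigidPart x).Normal := ⟨fun c hc t => by
  obtain ⟨k, hk⟩ := exists_step hd hodd x x t
  exact conj_mem_rigidPart hk hc⟩

/-- The braid relator of two adjacent generators has a single nontrivial section. -/
theorem braid_mem_rigidPart {d : ℕ} (hd : 3 ≤ d) (i : Fin d) :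
    (genG (next (next i)) * genG (next i))⁻¹ * (genG i * genG (next i)) ∈ rigidPart (next i) := by
  set j := next i with hj
  set k := next j with hk
  have hij : j ≠ i := next_ne hd i
  have hjk : k ≠ j := next_ne hd j
  have hik : k ≠ i := next_next_ne hd i
  have i1 : Step (genG i) i j (genG i) := Step.gen_self i
  have i2 : Step (genG i) j i (genG j) := Step.gen_next hij
  have i3 : ∀ {z}, z ≠ i → z ≠ j → Step (genG i) z z 1 := Step.gen_other
  have j1 : Step (genG j) j k (genG j) := Step.gen_self j
  have j2 : Step (genG j) k j (genG k) := Step.gen_next hjk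
  have j3 : ∀ {z}, z ≠ j → z ≠ k → Step (genG j) z z 1 := Step.gen_other
  -- Both sides of the braid relation swap `i` and `k` and fix `j`. Their sections differ only at
  -- `j`, where they are `a_i a_j` and `a_k a_j`.
  refine mem_rigidPart.2 ⟨(genG j * genG i * genG j)⁻¹ * (genG i * genG j * genG i), ?_, ?_⟩
  · have h1 := (i1.mul (j3 hij.symm hik.symm)).mul i2
    have h2 := (j2.mul (i3 hik hjk)).mul j1
    simpa using h2.inv.mul h1
  · intro z hz
    by_cases hzi : z = i
    · subst hzi
      have h1 := ((i3 hik hjk).mul j1).mul i1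
      have h2 := (j1.mul i1).mul (j3 hij.symm hik.symm)
      simpa using h2.inv.mul h1
    · by_cases hzk : z = k
      · subst hzk
        have h1 := (i2.mul j2).mul (i3 hik hjk)
        have h2 := ((j3 hij.symm hik.symm).mul i2).mul j2
        simpa using h2.inv.mul h1
      · have h1 := ((i3 hzi hz).mul (j3 hz hzk)).mul (i3 hzi hz)
        have h2 := ((j3 hz hzk).mul (i3 hzi hz)).mul (j3 hz hzk)
        simpa using h2.inv.mul h1

/-- Modulo the normal subgroup `rigidPart x` all generators agree, so the class of an element is the
power of this common class given by its exponent sum. -/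
theorem mem_rigidPart_of_expA {d : ℕ} (hd : 3 ≤ d) (hodd : Odd d) (x : Fin d) {c : G d}
    (hc : expA c = 0) : c ∈ rigidPart x := by
  have hN := rigidPart_normal hd hodd x
  have htwo : ∀ i : Fin d, (QuotientGroup.mk (genG (next (next i))) : G d ⧸ rigidPart x) =
      QuotientGroup.mk (genG i) := by
    intro i
    have h := braid_mem_rigidPart hd i
    rw [rigidPart_eq hd hodd (next i) x] at h
    refine QuotientGroup.eq.2 ?_
    -- Conjugating by `a_{i+1}` reduces the braid section to `a_{i+2}⁻¹ a_i`.
    have h' := hN.conj_mem _ h (genG (next i))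
    simpa [mul_assoc] using h'
  have hgen := eq_of_next_next hodd
    (F := fun i => (QuotientGroup.mk (genG i) : G d ⧸ rigidPart x)) htwo
  have hword : ∀ w : Word d, (QuotientGroup.mk (wordVal w) : G d ⧸ rigidPart x) =
      (QuotientGroup.mk (genG x)) ^ wordExpA w := by
    intro w
    induction w with
    | nil => simp [wordVal, wordExpA_nil]
    | cons l w ih =>
      have hl : (QuotientGroup.mk (letterVal l) : G d ⧸ rigidPart x) =
          (QuotientGroup.mk (genG x)) ^ letterSign l := by
        have h := hgen l.1 x
        unfold letterVal letterSign
        split_ifs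
        · rw [zpow_one]; exact h
        · rw [zpow_neg_one, ← h]; rfl
      rw [wordVal, QuotientGroup.mk_mul, ih, hl, ← zpow_add, wordExpA_cons, add_comm]
  obtain ⟨w, rfl⟩ := exists_word c
  rw [expA_wordVal hd] at hc
  have h := hword w
  rw [hc, zpow_zero] at h
  exact (QuotientGroup.eq_one_iff _).1 h

theorem mem_sectionTuples_of_expA {d : ℕ} (hd : 3 ≤ d) (hodd : Odd d) {s : Fin d → G d}
    (hs : ∀ x, expA (s x) = 0) : s ∈ sectionTuples d :=
  Subgroup.pi_mem_of_mulSingle_mem s fun x => mem_rigidPart_of_expA hd hodd x (hs x)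

/-! ### The lattice of exponent sums of section tuples -/

/-- The exponent sums of the tuples of sections. -/
def sectionExps {d : ℕ} (hd : 3 ≤ d) : AddSubgroup (Fin d → ℤ) where
  carrier := {e | ∃ s ∈ sectionTuples d, ∀ x, expA (s x) = e x}
  zero_mem' := ⟨1, one_mem _, fun _ => expA_one hd⟩
  add_mem' := fun ⟨s, hs, h1⟩ ⟨t, ht, h2⟩ =>
    ⟨s * t, mul_mem hs ht, fun x => by
      rw [Pi.mul_apply, expA_mul hd, h1, h2, Pi.add_apply]⟩
  neg_mem' := fun ⟨s, hs, h1⟩ =>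
    ⟨s⁻¹, inv_mem hs, fun x => by rw [Pi.inv_apply, expA_inv hd, h1, Pi.neg_apply]⟩

/-- Tuples with equal exponent sums differ by a tuple of elements of exponent sum 0, which always
occurs. -/
theorem mem_sectionTuples_iff_exps {d : ℕ} (hd : 3 ≤ d) (hodd : Odd d) {s : Fin d → G d} :
    s ∈ sectionTuples d ↔ (fun x => expA (s x)) ∈ sectionExps hd := by
  refine ⟨fun h => ⟨s, h, fun _ => rfl⟩, fun ⟨t, ht, h⟩ => ?_⟩
  have h1 : s * t⁻¹ ∈ sectionTuples d := mem_sectionTuples_of_expA hd hodd fun x => by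
    rw [Pi.mul_apply, Pi.inv_apply, expA_mul hd, expA_inv hd, h, add_neg_cancel]
  simpa using mul_mem h1 ht

/-- There is an element that swaps `x` and `y`, fixes the other letters, and whose sections have
exponent sums `e` at `x`, `2 - e` at `y` and `0` elsewhere. -/
def HasSwap {d : ℕ} (x y : Fin d) (e : ℤ) : Prop :=
  ∃ g : G d, (∃ t, Step g x y t ∧ expA t = e) ∧ (∃ t, Step g y x t ∧ expA t = 2 - e) ∧
    ∀ z, z ≠ x → z ≠ y → ∃ t, Step g z z t ∧ expA t = 0

theorem hasSwap_next {d : ℕ} (hd : 3 ≤ d) (x : Fin d) : HasSwap x (next x) 1 :=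
  ⟨genG x, ⟨_, Step.gen_self x, expA_genG hd x⟩,
    ⟨_, Step.gen_next (next_ne hd x), expA_genG hd _⟩,
    fun _ h1 h2 => ⟨1, Step.gen_other h1 h2, expA_one hd⟩⟩

theorem HasSwap.symm {d : ℕ} {x y : Fin d} {e : ℤ} (h : HasSwap x y e) :
    HasSwap y x (2 - e) := by
  obtain ⟨g, h1, h2, h3⟩ := h
  exact ⟨g, h2, by simpa using h1, fun z hy hx => h3 z hx hy⟩

/-- Conjugating by `a_y` moves the target `y` one step on. The path out of `x` gains the section
`a_y`, and the path back gains its inverse. -/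
theorem HasSwap.conj {d : ℕ} (hd : 3 ≤ d) {x y : Fin d} {e : ℤ} (h : HasSwap x y e)
    (hxy : x ≠ y) (hx : x ≠ next y) : HasSwap x (next y) (e + 1) := by
  obtain ⟨g, ⟨t1, h1, e1⟩, ⟨t2, h2, e2⟩, h3⟩ := h
  have hn := next_ne hd y
  have a1 : Step (genG y) y (next y) (genG y) := Step.gen_self y
  have a2 : Step (genG y) (next y) y (genG (next y)) := Step.gen_next hn
  have a3 : ∀ {z}, z ≠ y → z ≠ next y → Step (genG y) z z 1 := Step.gen_other
  refine ⟨genG y * g * (genG y)⁻¹, ⟨_, (a1.mul h1).mul (a3 hxy hx).inv, ?_⟩,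
    ⟨_, ((a3 hxy hx).mul h2).mul a1.inv, ?_⟩, fun z hzx hzy => ?_⟩
  · simp only [expA_mul hd, expA_inv hd, expA_genG hd, expA_one hd, e1]
    ring
  · simp only [expA_mul hd, expA_inv hd, expA_genG hd, expA_one hd, e2]
    ring
  · by_cases hz : z = y
    · subst hz
      obtain ⟨t, ht, et⟩ := h3 (next z) hx.symm hn
      refine ⟨_, (a2.mul ht).mul a2.inv, ?_⟩
      simp only [expA_mul hd, expA_inv hd, et]
      ring
    · obtain ⟨t, ht, et⟩ := h3 z hzx hz
      refine ⟨_, ((a3 hz hzy).mul ht).mul (a3 hz hzy).inv, ?_⟩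
      simp only [expA_mul hd, expA_inv hd, expA_one hd, et]
      ring

theorem hasSwap_iterate {d : ℕ} (hd : 3 ≤ d) (x : Fin d) (j : ℕ) (hj : j + 1 < d) :
    HasSwap x (next^[j + 1] x) (j + 1) := by
  induction j with
  | zero => simpa using hasSwap_next hd x
  | succ j ih =>
    have h1 := next_iterate_ne (d := d) (j := j + 1) (by omega) (by omega) x
    have h2 := next_iterate_ne (d := d) (j := j + 1 + 1) (by omega) (by omega) x
    rw [Function.iterate_succ_apply'] at h2 ⊢
    have h := (ih (by omega)).conj hd h1.symm h2.symm
    exact_mod_cast h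

/-- The quotient of two elements swapping the same letters fixes the first level; its exponent sums
are the differences. -/
theorem HasSwap.mem_sectionExps {d : ℕ} (hd : 3 ≤ d) {x y : Fin d} (hxy : x ≠ y) {e f : ℤ}
    (h : HasSwap x y e) (h' : HasSwap x y f) :
    (e - f) • (Pi.single x (1 : ℤ) - Pi.single y 1 : Fin d → ℤ) ∈ sectionExps hd := by
  obtain ⟨g, ⟨t1, h1, e1⟩, ⟨t2, h2, e2⟩, h3⟩ := h
  obtain ⟨g', ⟨t1', h1', e1'⟩, ⟨t2', h2', e2'⟩, h3'⟩ := h'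
  have key : ∀ z, ∃ t, Step (g'⁻¹ * g) z z t ∧
      expA t = ((e - f) • (Pi.single x (1 : ℤ) - Pi.single y 1 : Fin d → ℤ)) z := by
    intro z
    by_cases hzx : z = x
    · subst hzx
      refine ⟨_, h1'.inv.mul h1, ?_⟩
      simp only [expA_mul hd, expA_inv hd, e1, e1', Pi.smul_apply, Pi.sub_apply,
        Pi.single_eq_same, Pi.single_eq_of_ne hxy, smul_eq_mul]
      ring
    · by_cases hzy : z = y
      · subst hzy
        refine ⟨_, h2'.inv.mul h2, ?_⟩
        simp only [expA_mul hd, expA_inv hd, e2, e2', Pi.smul_apply, Pi.sub_apply,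
          Pi.single_eq_same, Pi.single_eq_of_ne hzx, smul_eq_mul]
        ring
      · obtain ⟨t, ht, et⟩ := h3 z hzx hzy
        obtain ⟨t', ht', et'⟩ := h3' z hzx hzy
        refine ⟨_, ht'.inv.mul ht, ?_⟩
        simp only [expA_mul hd, expA_inv hd, et, et', Pi.smul_apply, Pi.sub_apply,
          Pi.single_eq_of_ne hzx, Pi.single_eq_of_ne hzy, smul_eq_mul]
        ring
  choose s hs he using key
  exact ⟨s, ⟨_, hs⟩, he⟩

/-- The sections of `a_x²` at `x` and `x + 1` are products of two generators. -/
theorem two_smul_add_mem_sectionExps {d : ℕ} (hd : 3 ≤ d) (x : Fin d) :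
    (2 : ℤ) • (Pi.single x (1 : ℤ) + Pi.single (next x) 1 : Fin d → ℤ) ∈ sectionExps hd := by
  have hn := next_ne hd x
  have a1 : Step (genG x) x (next x) (genG x) := Step.gen_self x
  have a2 : Step (genG x) (next x) x (genG (next x)) := Step.gen_next hn
  have key : ∀ z, ∃ t, Step (genG x * genG x) z z t ∧
      expA t = ((2 : ℤ) • (Pi.single x (1 : ℤ) + Pi.single (next x) 1 : Fin d → ℤ)) z := by
    intro z
    by_cases hzx : z = x
    · subst hzx
      exact ⟨_, a2.mul a1, by simp [expA_mul hd, expA_genG hd, hn.symm]⟩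
    · by_cases hzy : z = next x
      · subst hzy
        exact ⟨_, a1.mul a2, by simp [expA_mul hd, expA_genG hd, hn]⟩
      · have a3 : Step (genG x) z z 1 := Step.gen_other hzx hzy
        exact ⟨_, a3.mul a3, by simp [expA_one hd, hzx, hzy]⟩
  choose s hs he using key
  exact ⟨s, ⟨_, hs⟩, he⟩

/-- The first relation gives `2 f(x) = -2 f(x + 1) = 2 f(x + 2)`, so `2 f` is constant on the odd
cycle. Hence consecutive differences are killed by 2 and by the odd number `d - 2`, and vanish. -/
theorem const_of_cyclic_relations {d : ℕ} (hodd : Odd d) {Q : Type*} [AddCommGroup Q]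
    {f : Fin d → Q} (hadd : ∀ x, (2 : ℤ) • (f x + f (next x)) = 0)
    (hsub : ∀ x, ((d : ℤ) - 2) • (f (next x) - f x) = 0) (x y : Fin d) :
    f x = f y ∧ (4 : ℤ) • f x = 0 := by
  have htwo : ∀ x y, (2 : ℤ) • f x = (2 : ℤ) • f y := by
    refine eq_of_next_next hodd (F := fun x => (2 : ℤ) • f x) fun x => ?_
    have h1 := hadd x
    have h2 := hadd (next x)
    rw [smul_add] at h1 h2
    rw [add_comm] at h1
    exact (eq_neg_of_add_eq_zero_right h2).trans (eq_neg_of_add_eq_zero_right h1).symm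
  have hconst : ∀ x y, f x = f y := by
    refine eq_of_next fun x => ?_
    obtain ⟨m, hm⟩ := hodd
    have h1 := hsub x
    have h2 : (2 : ℤ) • (f (next x) - f x) = 0 := by
      rw [smul_sub, htwo (next x) x, sub_self]
    have h3 : ((d : ℤ) - 2) = 1 + (m - 1) * 2 := by rw [hm]; push_cast; ring
    rw [h3, add_smul, mul_smul, h2, smul_zero, add_zero, one_smul] at h1
    exact sub_eq_zero.1 h1
  refine ⟨hconst x y, ?_⟩
  have h := hadd x
  rw [hconst (next x) x, ← two_smul ℤ (f x), smul_smul] at h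
  exact h

theorem mem_sectionExps_of_dvd {d : ℕ} (hd : 3 ≤ d) (hodd : Odd d) {e : Fin d → ℤ}
    (he : 4 ∣ ∑ x, e x) : e ∈ sectionExps hd := by
  let q := QuotientAddGroup.mk' (sectionExps hd)
  have hq : ∀ v, q v = 0 ↔ v ∈ sectionExps hd := QuotientAddGroup.eq_zero_iff
  let f : Fin d → (Fin d → ℤ) ⧸ sectionExps hd := fun x => q (Pi.single x 1)
  have hf := const_of_cyclic_relations (f := f) hodd
    (fun x => by
      rw [← map_add, ← map_zsmul, hq]
      exact two_smul_add_mem_sectionExps hd x)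
    (fun x => by
      rw [← map_sub, ← map_zsmul, hq]
      have h1 := (hasSwap_next hd x).symm
      -- The swap of `x + 1` and `x` the long way round takes `d - 1` steps and has exponent `d -
      -- 1`; `a_x` itself has exponent 1. The difference is `d - 2`.
      have h2 := hasSwap_iterate hd (next x) (d - 2) (by omega)
      rw [← Function.iterate_succ_apply, show (d - 2 + 1).succ = d by omega,
        next_iterate_card] at h2
      have h := HasSwap.mem_sectionExps hd (next_ne hd x) h2 h1
      rwa [show ((d - 2 : ℕ) : ℤ) + 1 - (2 - 1) = (d : ℤ) - 2 by omega] at h)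
  let x₀ : Fin d := ⟨0, by omega⟩
  have h1 : e = ∑ x, e x • (Pi.single x 1 : Fin d → ℤ) := by
    ext z
    simp [Finset.sum_apply, Pi.single_apply]
  have hsum : q e = q ((∑ x, e x) • (Pi.single x₀ 1 : Fin d → ℤ)) := by
    conv_lhs => rw [h1]
    rw [Finset.sum_smul, map_sum, map_sum]
    refine Finset.sum_congr rfl fun x _ => ?_
    rw [map_zsmul, map_zsmul]
    exact congrArg _ (hf x x₀).1
  obtain ⟨c, hc⟩ := he
  rw [hc, mul_comm, mul_smul, map_zsmul, map_zsmul] at hsum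
  rw [← hq, hsum]
  exact (congrArg _ (hf x₀ x₀).2).trans (smul_zero c)

theorem mem_sectionTuples_iff {d : ℕ} (hd : 3 ≤ d) (hodd : Odd d) {s : Fin d → G d} :
    s ∈ sectionTuples d ↔ 4 ∣ ∑ x, expA (s x) := by
  constructor
  · rintro ⟨g, hg⟩
    obtain ⟨c, hc⟩ := even_expA hd hg
    exact ⟨c, by rw [sum_expA_sections hd hg, hc]; ring⟩
  · intro h
    exact (mem_sectionTuples_iff_exps hd hodd).2 (mem_sectionExps_of_dvd hd hodd h)

/-! ### The levels of the tree -/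

/-- The index of the child `x` of the `m`-th vertex of level `k`. -/
def childIndex {d k : ℕ} (m : Fin (d ^ k)) (x : Fin d) : Fin (d ^ (k + 1)) :=
  Fin.cast (pow_succ d k).symm (finProdFinEquiv (m, x))

theorem val_childIndex {d k : ℕ} (m : Fin (d ^ k)) (x : Fin d) :
    (childIndex m x : ℕ) = d * m + x := by
  simp [childIndex, finProdFinEquiv, add_comm]

theorem exists_childIndex_eq {d k : ℕ} (n : Fin (d ^ (k + 1))) : ∃ m x, childIndex m x = n := by
  refine ⟨(finProdFinEquiv.symm (Fin.cast (pow_succ d k) n)).1,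
    (finProdFinEquiv.symm (Fin.cast (pow_succ d k) n)).2, ?_⟩
  rw [childIndex, Prod.mk.eta, Equiv.apply_symm_apply]
  rfl

theorem levelVertex_childIndex {d k : ℕ} (m : Fin (d ^ k)) (x : Fin d) :
    levelVertex d (k + 1) (childIndex m x) = levelVertex d k m ++ [x] := by
  have h := finProdFinEquiv.symm_apply_apply (m, x)
  have h1 : (finProdFinEquiv (m, x)).divNat = m := congrArg Prod.fst h
  have h2 : (finProdFinEquiv (m, x)).modNat = x := congrArg Prod.snd h
  simp only [levelVertex, childIndex, Fin.cast_cast, Fin.cast_eq_self, h1, h2]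

theorem exists_levelVertex_eq {d k : ℕ} (u : List (Fin d)) (hu : u.length = k) :
    ∃ m, levelVertex d k m = u := by
  induction k generalizing u with
  | zero => exact ⟨⟨0, by simp⟩, (List.length_eq_zero_iff.1 hu).symm⟩
  | succ k ih =>
    obtain ⟨v, x, rfl⟩ : ∃ v x, u = v ++ [x] := by
      have hne : u ≠ [] := by rintro rfl; simp at hu
      exact ⟨_, _, (List.dropLast_append_getLast hne).symm⟩
    obtain ⟨m, hm⟩ := ih v (by simpa using hu)
    exact ⟨childIndex m x, by rw [levelVertex_childIndex, hm]⟩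

theorem mem_range_psi {d k : ℕ} {h : Fin (d ^ k) → G d} :
    h ∈ (psi d k).range ↔ ∃ g : G d, ∀ m v,
      g.1.1 (levelVertex d k m ++ v) = levelVertex d k m ++ (h m).1.1 v := by
  constructor
  · rintro ⟨g, rfl⟩
    refine ⟨g.1, fun m v => ?_⟩
    rw [apply_append_sect, g.2 _ (length_levelVertex d k m)]
    rfl
  · rintro ⟨g, hg⟩
    have hfix : ∀ m, g.1.1 (levelVertex d k m) = levelVertex d k m := by
      intro m
      have h0 := hg m []
      have h1 : (h m).1.1 [] = [] := (h m).1.2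
      rwa [h1, List.append_nil] at h0
    refine ⟨⟨g, fun u hu => ?_⟩, funext fun m => Subtype.ext (sect_eq fun v => ?_)⟩
    · obtain ⟨m, rfl⟩ := exists_levelVertex_eq u hu
      exact hfix m
    · change g.1.1 _ = g.1.1 _ ++ _
      rw [hg, hfix]

theorem mem_range_psi_zero {d : ℕ} (h : Fin (d ^ 0) → G d) : h ∈ (psi d 0).range := by
  refine mem_range_psi.2 ⟨h ⟨0, by simp⟩, fun m v => ?_⟩
  have hm : m = ⟨0, by simp⟩ := Fin.ext (by have := m.isLt; simp at this; simp [this])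
  rw [hm]
  rfl

/-- This is the induction step on levels: the section at a vertex of level `k` fixes the children of
that vertex, and its sections there are the entries on level `k + 1`. -/
theorem mem_range_psi_succ {d k : ℕ} (hd : 0 < d) {h : Fin (d ^ (k + 1)) → G d} :
    h ∈ (psi d (k + 1)).range ↔ ∃ f ∈ (psi d k).range,
      ∀ m x, Step (f m) x x (h (childIndex m x)) := by
  constructor
  · intro hh
    obtain ⟨g, hg⟩ := mem_range_psi.1 hh
    have hfix : ∀ m, g.1.1 (levelVertex d k m) = levelVertex d k m := by
      intro m
      have h0 := hg (childIndex m ⟨0, hd⟩) []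
      have h1 : (h (childIndex m ⟨0, hd⟩)).1.1 [] = [] := (h _).1.2
      rw [h1, levelVertex_childIndex, List.append_nil, apply_append_sect] at h0
      exact List.append_inj_left h0 (length_apply _ _)
    refine ⟨fun m => ⟨sect g.1 (levelVertex d k m), sect_mem g.2 _⟩,
      mem_range_psi.2 ⟨g, fun m v => ?_⟩, fun m x v => ?_⟩
    · conv_lhs => rw [apply_append_sect, hfix]
    · have h1 := hg (childIndex m x) v
      rw [levelVertex_childIndex, List.append_assoc, apply_append_sect, hfix,
        List.append_assoc] at h1
      exact List.append_cancel_left h1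
  · rintro ⟨f, hf, hs⟩
    obtain ⟨g, hg⟩ := mem_range_psi.1 hf
    refine mem_range_psi.2 ⟨g, fun n v => ?_⟩
    obtain ⟨m, x, rfl⟩ := exists_childIndex_eq n
    rw [levelVertex_childIndex, List.append_assoc, hg, List.append_assoc]
    exact congrArg _ (hs m x v)

/-! ### Block sums on consecutive levels -/

/-- The children of the vertices in a block of length `d ^ r` form the block of length `d ^ (r + 1)`
with the same number `t`. -/
theorem sum_blockIndex_succ {d k r : ℕ} (hr : r ≤ k) {M : Type*} [AddCommMonoid M]
    (F : Fin (d ^ (k + 1)) → M) (t : Fin (d ^ (k - r))) (t' : Fin (d ^ (k + 1 - (r + 1))))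
    (ht : (t' : ℕ) = t) :
    ∑ i, F (blockIndex (Nat.succ_le_succ hr) t' i) =
      ∑ i, ∑ x, F (childIndex (blockIndex hr t i) x) := by
  rw [← (finCongr (pow_succ d r).symm).sum_comp, ← finProdFinEquiv.sum_comp,
    Fintype.sum_prod_type]
  refine Finset.sum_congr rfl fun i _ => Finset.sum_congr rfl fun x _ => congrArg F ?_
  apply Fin.ext
  rw [val_childIndex]
  simp only [blockIndex, finCongr_apply, Fin.val_cast, finProdFinEquiv_apply_val, ht,
    Nat.succ_eq_add_one]
  ring

/-- The congruences that describe the image of `psi d k`. -/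
def BlockCongr {d k : ℕ} (h : Fin (d ^ k) → G d) : Prop :=
  ∀ (r : ℕ) (_ : 1 ≤ r) (hrk : r ≤ k) (t : Fin (d ^ (k - r))),
    (∑ i : Fin (d ^ r), expA (h (blockIndex hrk t i))) ≡ 0 [ZMOD 2 ^ (r + 1)]

theorem sum_block_of_step {d k r : ℕ} (hd : 3 ≤ d) (hr : r ≤ k) {h : Fin (d ^ (k + 1)) → G d}
    {f : Fin (d ^ k) → G d} (hf : ∀ m x, Step (f m) x x (h (childIndex m x)))
    (t : Fin (d ^ (k - r))) (t' : Fin (d ^ (k + 1 - (r + 1)))) (ht : (t' : ℕ) = t) :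
    ∑ i, expA (h (blockIndex (Nat.succ_le_succ hr) t' i)) =
      2 * ∑ i, expA (f (blockIndex hr t i)) := by
  rw [sum_blockIndex_succ hr (fun n => expA (h n)) t t' ht, Finset.mul_sum]
  exact Finset.sum_congr rfl fun i _ => sum_expA_sections hd (hf _)

/-- The block sums of `h` are twice those of `f` on the parent blocks, so the condition for `r + 1`
on `h` is the condition for `r` on `f`. -/
theorem blockCongr_succ {d k : ℕ} (hd : 3 ≤ d) {h : Fin (d ^ (k + 1)) → G d}
    {f : Fin (d ^ k) → G d} (hf : ∀ m x, Step (f m) x x (h (childIndex m x))) :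
    BlockCongr h ↔ BlockCongr f := by
  constructor
  · intro hh r hr hrk t
    have h1 := hh (r + 1) (by omega) (Nat.succ_le_succ hrk)
      (Fin.cast (by rw [Nat.add_sub_add_right]) t)
    rw [sum_block_of_step hd hrk hf t _ rfl, Int.modEq_zero_iff_dvd, pow_succ' 2 (r + 1)] at h1
    exact Int.modEq_zero_iff_dvd.2 (Int.dvd_of_mul_dvd_mul_left (by norm_num) h1)
  · intro hh r hr hrk t
    obtain ⟨r, rfl⟩ : ∃ r', r = r' + 1 := ⟨r - 1, by omega⟩
    have hrk' : r ≤ k := by omega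
    rw [sum_block_of_step hd hrk' hf (Fin.cast (by rw [Nat.add_sub_add_right]) t) t rfl,
      Int.modEq_zero_iff_dvd, pow_succ' 2 (r + 1)]
    refine mul_dvd_mul_left 2 ?_
    -- For `r = 0` nothing is assumed about `f`; the parity holds because each `f m` fixes the first
    -- level.
    rcases Nat.eq_zero_or_pos r with rfl | hr0
    · refine Finset.dvd_sum fun i _ => ?_
      exact (pow_one (2 : ℤ)).dvd.trans (even_expA hd (hf _)).two_dvd
    · exact Int.modEq_zero_iff_dvd.1 (hh r hr0 hrk' _)

theorem exists_of_blockCongr {d k : ℕ} (hd : 3 ≤ d) (hodd : Odd d)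
    {h : Fin (d ^ (k + 1)) → G d} (hh : BlockCongr h) :
    ∃ f : Fin (d ^ k) → G d, ∀ m x, Step (f m) x x (h (childIndex m x)) := by
  have key : ∀ m : Fin (d ^ k), (fun x => h (childIndex m x)) ∈ sectionTuples d := by
    intro m
    rw [mem_sectionTuples_iff hd hodd]
    let t' : Fin (d ^ (k + 1 - (0 + 1))) := Fin.cast (by simp) m
    -- Only the congruences for blocks of length `d`, modulo 4, are needed: each such block is one
    -- family of siblings.
    have h1 := hh (0 + 1) le_rfl (Nat.succ_le_succ (Nat.zero_le k)) t'
    rw [sum_blockIndex_succ (Nat.zero_le k) (fun n => expA (h n)) m t' rfl,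
      Int.modEq_zero_iff_dvd] at h1
    have hidx : ∀ i : Fin (d ^ 0), blockIndex (Nat.zero_le k) m i = m := by
      intro i
      have hi : (i : ℕ) = 0 := by have := i.isLt; simpa using this
      exact Fin.ext (by simp [blockIndex, hi])
    have h2 : ∑ i : Fin (d ^ 0), ∑ x, expA (h (childIndex (blockIndex (Nat.zero_le k) m i) x)) =
        ∑ i : Fin (d ^ 0), ∑ x, expA (h (childIndex m x)) :=
      Finset.sum_congr rfl fun i _ => by rw [hidx i]
    rw [h2, Finset.sum_const, Finset.card_univ, Fintype.card_fin, pow_zero, one_smul] at h1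
    exact h1
  choose f hf using key
  exact ⟨f, hf⟩

theorem mem_range_psi_iff {d : ℕ} (hd : 3 ≤ d) (hodd : Odd d) (k : ℕ)
    (h : Fin (d ^ k) → G d) : h ∈ (psi d k).range ↔ BlockCongr h := by
  induction k with
  | zero => exact ⟨fun _ r hr hrk => absurd (hr.trans hrk) (by simp), fun _ => mem_range_psi_zero h⟩
  | succ k ih =>
    rw [mem_range_psi_succ (by omega)]
    constructor
    · rintro ⟨f, hf, hs⟩
      exact (blockCongr_succ hd hs).2 ((ih f).1 hf)
    · intro hh
      obtain ⟨f, hs⟩ := exists_of_blockCongr hd hodd hh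
      exact ⟨f, (ih f).2 ((blockCongr_succ hd hs).1 hh), hs⟩

end TreeGroup

theorem mainTheorem3 (d : ℕ) (hd : 3 ≤ d) (hodd : Odd d) :
    -- `|g|_A` does not depend on the word that represents `g`
    (∀ w : TreeGroup.Word d, TreeGroup.expA (TreeGroup.wordVal w) = TreeGroup.wordExpA w) ∧
    ∀ (k : ℕ), 1 ≤ k → ∀ h : Fin (d ^ k) → TreeGroup.G d,
      h ∈ (TreeGroup.psi d k).range ↔
        ∀ (r : ℕ) (_ : 1 ≤ r) (hrk : r ≤ k) (t : Fin (d ^ (k - r))),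
          (∑ i : Fin (d ^ r), TreeGroup.expA (h (TreeGroup.blockIndex hrk t i)))
            ≡ 0 [ZMOD 2 ^ (r + 1)] :=
  ⟨TreeGroup.expA_wordVal hd, fun k _ h => TreeGroup.mem_range_psi_iff hd hodd k h⟩
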